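/- Let $m\equiv 5\pmod 8$ be a positive integer, $n=2^m-1$, and let $\alpha$ be a primitive element of $\mathbb F_{2^m}$. For $j\ge 0$ let $w_2(j)$ be the number of ones in the binary expansion of $j$. For $S\subset\mathbb Z_8$ with $|S|=4$ let $S'=\mathbb Z_8\setminus S$, let $$T_{[8,m,S]}=\{1\le j\le n-1:\ w_2(j)\bmod 8\in S\},$$ and let $\mathcal C_{[8,m,S]}$ be the binary cyclic code of length $n$ with generator polynomial $\prod_{i\in T_{[8,m,S]}}(x-\alpha^i)$. (Terminology. The defining set of a binary cyclic code of length $n$ with generator polynomial $g$ is $\{i\in\mathbb Z_n:\ g(\alpha^i)=0\}$. Two binary cyclic codes with defining sets $S_1,S_2$ form a pair of odd-like duadic codes if $S_1,S_2$ are unions of $2$-cyclotomic cosets modulo $n$ which partition $\mathbb Z_n\setminus\{0\}$ and there is a unit $\mu$ of $\mathbb Z_n$ with $\mu S_1=S_2$, $\mu S_2=S_1$; two binary cyclic codes with defining sets $\{0\}\cup S_1,\{0\}\cup S_2$, for such $S_1,S_2$, form a pair of even-like duadic codes. The extended code is obtained by appending a parity check coordinate to each codeword. A binary code is doubly-even if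 all its weights are divisible by $4$. A pair of codes has parameters $[N,k,d]$ if both have length $N$, dimension $k$ and minimum distance $d$.) Suppose that $S$ and $b$ are given by one of the following cases: 1. $S=\{0,1,2,6\}$ and $b=1$; 2. $S=\{0,1,3,7\}$ and $b=3$; 3. $S\in\{\{0,1,2,7\},\{0,3,4,6\}\}$, and $b=1$ if $m\equiv5\pmod{16}$, $b=3$ if $m\equiv13\pmod{16}$; 4. $S\in\{\{0,1,3,6\},\{0,2,4,7\}\}$, and $b=3$ if $m\equiv5\pmod{16}$, $b=1$ if $m\equiv13\pmod{16}$. Then: (i) $\mathcal C_{[8,m,S]}$ and $\mathcal C_{[8,m,S']}$ form a pair of odd-like duadic codes with parameters $[2^m-1,\,2^{m-1},\,d]$, where $d\ge 2^{(m-1)/2}+b$. (ii) The dual codes $\mathcal C_{[8,m,S]}^{\perp}$ and $\mathcal C_{[8,m,S']}^{\perp}$ form a pair of even-like duadic codes with parameters $[2^m-1,\,2^{m-1}-1,\,d^{\perp}]$, where $d^{\perp}\ge 2^{(m-1)/2}+b+1$. (iii) The extended codes $\overline{\mathcal C_{[8,m,S]}}$ and $\overline{\mathcal C_{[8,m,S']}}$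 have parameters $[2^m,\,2^{m-1},\,\overline d]$, where $\overline d\ge 2^{(m-1)/2}+4$; both are self-dual and doubly-even. -/

import Mathlib

open Polynomial

/-- A binary linear code with coordinates indexed by `Fin n`, i.e. of length `n`. -/
abbrev BinaryCode (n : ℕ) : Type := Submodule (ZMod 2) (Fin n → ZMod 2)

namespace BinaryCode

/-- The minimum (Hamming) distance of a code: the least distance between distinct codewords
(`0` by convention if there are no two distinct codewords). -/
noncomputable def minDist {n : ℕ} (C : BinaryCode n) : ℕ :=
  sInf {d : ℕ | ∃ x ∈ C, ∃ y ∈ C, x ≠ y ∧ hammingDist x y = d}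

/-- Both `C₁` and `C₂` have parameters `[n, k, d]` with the same `d`, and `d ≥ b`. -/
def PairParameters {n : ℕ} (C₁ C₂ : BinaryCode n) (k b : ℕ) : Prop :=
  Module.finrank (ZMod 2) C₁ = k ∧ Module.finrank (ZMod 2) C₂ = k ∧
    minDist C₁ = minDist C₂ ∧ b ≤ minDist C₁

/-- The dual code, with respect to the standard inner product. -/
def dual {n : ℕ} (C : BinaryCode n) : BinaryCode n where
  carrier := {x | ∀ c ∈ C, ∑ i, x i * c i = 0}
  zero_mem' := by
    intro c _
    simp
  add_mem' := by
    intro x y hx hy c hc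
    simp [add_mul, Finset.sum_add_distrib, hx c hc, hy c hc]
  smul_mem' := by
    intro a x hx c hc
    simp [mul_assoc, ← Finset.mul_sum, hx c hc]

/-- The extended code: a parity coordinate is appended to every codeword. -/
def extended {n : ℕ} (C : BinaryCode n) : BinaryCode (n + 1) where
  carrier := {x | (fun i : Fin n => x i.castSucc) ∈ C ∧ ∑ i, x i = 0}
  zero_mem' := ⟨C.zero_mem, by simp⟩
  add_mem' := by
    rintro x y ⟨hx, hx'⟩ ⟨hy, hy'⟩
    exact ⟨C.add_mem hx hy, by simp [Finset.sum_add_distrib, hx', hy']⟩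
  smul_mem' := by
    rintro a x ⟨hx, hx'⟩
    exact ⟨C.smul_mem a hx, by simp [← Finset.mul_sum, hx']⟩

/-- A code is self-dual if it equals its dual. -/
def IsSelfDual {n : ℕ} (C : BinaryCode n) : Prop := dual C = C

/-- A binary code is doubly-even if all its weights are divisible by `4`. -/
def IsDoublyEven {n : ℕ} (C : BinaryCode n) : Prop := ∀ c ∈ C, 4 ∣ hammingNorm c

/-- The polynomial `c₀ + c₁ X + ⋯ + c_{n-1} X^{n-1}` of a word `c`. -/
noncomputable def wordPoly {n : ℕ} (c : Fin n → ZMod 2) : (ZMod 2)[X] :=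
  ∑ i : Fin n, C (c i) * X ^ (i : ℕ)

/-- `D` is the binary cyclic code of length `n` with generator polynomial `g`: `g` is a monic
divisor of `X ^ n - 1`, and the codewords are the words whose polynomials are multiples of `g`. -/
def IsGeneratorPoly {n : ℕ} (g : (ZMod 2)[X]) (D : BinaryCode n) : Prop :=
  g.Monic ∧ g ∣ X ^ n - 1 ∧ ∀ c : Fin n → ZMod 2, c ∈ D ↔ g ∣ wordPoly c

variable {F : Type*} [Field F] [Algebra (ZMod 2) F]

/-- `D` is cyclic with defining set `T` relative to `α`: `T` is the set of the exponents `i` modulo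
`n` for which `α ^ i` is a root of the generator polynomial of `D`. -/
def HasDefiningSet {n : ℕ} (α : F) (D : BinaryCode n) (T : Set (ZMod n)) : Prop :=
  ∃ g : (ZMod 2)[X], IsGeneratorPoly g D ∧ T = {i : ZMod n | aeval (α ^ i.val) g = 0}

/-- The `2`-cyclotomic coset of `s` modulo `n`. -/
def cyclotomicCoset (n : ℕ) (s : ZMod n) : Set (ZMod n) := {x | ∃ t : ℕ, x = s * 2 ^ t}

/-- `(S₁, S₂, μ)` is a splitting of `ℤ / n`: both sets are unions of `2`-cyclotomic cosets,
they partition the nonzero residues, and multiplication by the unit `μ` swaps them. -/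
def IsSplitting {n : ℕ} (S₁ S₂ : Set (ZMod n)) (μ : (ZMod n)ˣ) : Prop :=
  (∃ A : Set (ZMod n), S₁ = ⋃ s ∈ A, cyclotomicCoset n s) ∧
  (∃ A : Set (ZMod n), S₂ = ⋃ s ∈ A, cyclotomicCoset n s) ∧
  S₁ ∪ S₂ = {0}ᶜ ∧ S₁ ∩ S₂ = ∅ ∧
  (fun i : ZMod n => i * (μ : ZMod n)) '' S₁ = S₂ ∧
  (fun i : ZMod n => i * (μ : ZMod n)) '' S₂ = S₁

/-- `C₁` and `C₂` form a pair of odd-like duadic codes. -/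
def IsOddLikeDuadicPair {n : ℕ} (α : F) (C₁ C₂ : BinaryCode n) : Prop :=
  ∃ (S₁ S₂ : Set (ZMod n)) (μ : (ZMod n)ˣ), IsSplitting S₁ S₂ μ ∧
    HasDefiningSet α C₁ S₁ ∧ HasDefiningSet α C₂ S₂

/-- `C₁` and `C₂` form a pair of even-like duadic codes. -/
def IsEvenLikeDuadicPair {n : ℕ} (α : F) (C₁ C₂ : BinaryCode n) : Prop :=
  ∃ (S₁ S₂ : Set (ZMod n)) (μ : (ZMod n)ˣ), IsSplitting S₁ S₂ μ ∧
    HasDefiningSet α C₁ ({0} ∪ S₁) ∧ HasDefiningSet α C₂ ({0} ∪ S₂)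

/-- The number of ones in the binary expansion of `j`. -/
def binaryWeight (j : ℕ) : ℕ := (Nat.digits 2 j).sum

/-- The set of all `1 ≤ j ≤ n - 1`, where `n = 2 ^ m - 1`, whose binary weight
modulo `r` lies in `S`. -/
def definingExponents (r m : ℕ) (S : Finset (ZMod r)) : Finset ℕ :=
  (Finset.Icc 1 (2 ^ m - 1 - 1)).filter fun j => (binaryWeight j : ZMod r) ∈ S

/-- The product of all `X - α ^ i` with `i` in `definingExponents r m S`. -/
noncomputable def duadicGenerator (r m : ℕ) (S : Finset (ZMod r)) (α : F) : F[X] :=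
  ∏ i ∈ definingExponents r m S, (X - C (α ^ i))

/-- The code of length `2 ^ m - 1` over the field of two elements that consists of the words
whose polynomials are divisible by `duadicGenerator r m S α`. (Divisibility is written over `F`;
if the generator has coefficients in `ZMod 2` this is divisibility over `ZMod 2`.) -/
noncomputable def duadicCode (r m : ℕ) (S : Finset (ZMod r)) (α : F) : BinaryCode (2 ^ m - 1) where
  carrier := {c | duadicGenerator r m S α ∣ (wordPoly c).map (algebraMap (ZMod 2) F)}
  zero_mem' := by
    simp [wordPoly]
  add_mem' := by
    intro x y hx hy
    have h : wordPoly (x + y) = wordPoly x + wordPoly y := by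
      simp [wordPoly, add_mul, Finset.sum_add_distrib]
    simpa [h] using dvd_add hx hy
  smul_mem' := by
    intro a x hx
    have h : wordPoly (a • x) = C a * wordPoly x := by
      simp [wordPoly, Finset.mul_sum, mul_assoc]
    simpa [h] using Dvd.dvd.mul_left hx (C (algebraMap (ZMod 2) F a))

end BinaryCode

/-! Write `n = 2 ^ m - 1`. Doubling an exponent modulo `n` rotates its `m` binary digits, and
negating it flips them. So squaring a root `α ^ j` preserves the binary weight of `j`, and inverting
it replaces that weight by `m` minus it. For `m ≡ 5` modulo 8, each listed `S` is exchanged with its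
complement by `s ↦ 5 - s`. Hence the two root sets are swapped by inversion, which gives the
splitting with multiplier `-1`. Parseval's identity over the `n`-th roots of unity then gives the
duals (the root 1 is added) and the self-duality of the extended codes. Double evenness: on a
self-orthogonal code the weight modulo 4 is additive. The `n` cyclic shifts of an extended word sum
to a constant word, whose weight is 0 or `n + 1`, a multiple of 4. As `n` is odd, the weight of the
word itself is divisible by 4. Distance: put `m = 2 * k + 1`. Since `k + (k + 1) = m`, one of these
two weights, say `K`, lies in `S` modulo 8. The multiples `(2 ^ K - 1) * i` with `1 ≤ i ≤ 2 ^ k` all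
have binary weight `K`, and `2 ^ K - 1` is prime to `n`, so the BCH bound gives weight at least `2 ^
k + 1`. As `4 ∣ 2 ^ k`, double evenness raises this to `2 ^ k + 4` after extension, hence to `2 ^ k
+ 3` for the code and `2 ^ k + 4` for its dual. All values of `b` are at most 3, so every case is
covered at once. -/

namespace BinaryCode

/-! ### Cyclic codes given by their root sets -/

section Roots

variable {F : Type*} [Field F]

/-- The monic polynomial with simple roots exactly at `R`. -/
noncomputable def rootPoly (R : Finset F) : F[X] := ∏ β ∈ R, (X - C β)

theorem rootPoly_dvd_iff (R : Finset F) (p : F[X]) :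
    rootPoly R ∣ p ↔ ∀ β ∈ R, p.eval β = 0 := by
  constructor
  · intro h β hβ
    have hd : X - C β ∣ rootPoly R := Finset.dvd_prod_of_mem (fun β => X - C β) hβ
    exact dvd_iff_isRoot.1 (hd.trans h)
  · intro h
    refine Finset.prod_dvd_of_coprime (fun a _ b _ hab => ?_)
      fun β hβ => dvd_iff_isRoot.2 (h β hβ)
    exact isCoprime_X_sub_C_of_isUnit_sub (sub_ne_zero.2 hab).isUnit

theorem monic_rootPoly (R : Finset F) : (rootPoly R).Monic :=
  monic_prod_of_monic _ _ fun β _ => monic_X_sub_C β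

theorem natDegree_rootPoly (R : Finset F) : (rootPoly R).natDegree = R.card := by
  rw [rootPoly, natDegree_finsetProd_X_sub_C_eq_card]

theorem eval_rootPoly_eq_zero (R : Finset F) (β : F) : (rootPoly R).eval β = 0 ↔ β ∈ R := by
  rw [rootPoly, eval_prod, Finset.prod_eq_zero_iff]
  constructor
  · rintro ⟨a, ha, h⟩
    rw [eval_sub, eval_X, eval_C, sub_eq_zero] at h
    exact h ▸ ha
  · intro h
    exact ⟨β, h, by simp⟩

variable [Algebra (ZMod 2) F] {n : ℕ}

theorem aeval_wordPoly (β : F) (c : Fin n → ZMod 2) :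
    aeval β (wordPoly c) = ∑ j, algebraMap (ZMod 2) F (c j) * β ^ (j : ℕ) := by
  simp [wordPoly]

theorem wordPoly_add (x y : Fin n → ZMod 2) : wordPoly (x + y) = wordPoly x + wordPoly y := by
  simp [wordPoly, add_mul, Finset.sum_add_distrib]

theorem wordPoly_smul (a : ZMod 2) (x : Fin n → ZMod 2) : wordPoly (a • x) = a • wordPoly x := by
  simp [wordPoly, Finset.smul_sum, smul_eq_C_mul, mul_assoc]

/-- The linear map sending a word to its polynomial. -/
noncomputable def wordPolyLinear (n : ℕ) : (Fin n → ZMod 2) →ₗ[ZMod 2] (ZMod 2)[X] where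
  toFun := wordPoly
  map_add' := wordPoly_add
  map_smul' := wordPoly_smul

theorem exists_wordPoly_eq (p : (ZMod 2)[X]) (hp : p.degree < n) :
    ∃ c : Fin n → ZMod 2, wordPoly c = p := by
  refine ⟨fun i => p.coeff i, ?_⟩
  rw [wordPoly, Fin.sum_univ_eq_sum_range (fun i => C (p.coeff i) * X ^ i) n]
  rcases eq_or_ne p 0 with rfl | h0
  · simp
  · exact (p.as_sum_range_C_mul_X_pow' ((natDegree_lt_iff_degree_lt h0).2 hp)).symm

/-- The words of length `n` whose polynomials vanish on `R`. -/
noncomputable def cyclicCode (n : ℕ) (R : Finset F) : BinaryCode n where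
  carrier := {c | ∀ β ∈ R, aeval β (wordPoly c) = 0}
  zero_mem' := by
    intro β _
    simp [wordPoly]
  add_mem' := by
    intro x y hx hy β hβ
    rw [wordPoly_add, map_add, hx β hβ, hy β hβ, add_zero]
  smul_mem' := by
    intro a x hx β hβ
    rw [wordPoly_smul, map_smul, hx β hβ, smul_zero]

theorem mem_cyclicCode {R : Finset F} {c : Fin n → ZMod 2} :
    c ∈ cyclicCode n R ↔ ∀ β ∈ R, aeval β (wordPoly c) = 0 := Iff.rfl

/-- A polynomial whose simple roots are permuted by squaring is defined over `ZMod 2`. -/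
theorem exists_map_eq_rootPoly (R : Finset F) (hR : ∀ β ∈ R, β ^ 2 ∈ R) :
    ∃ g : (ZMod 2)[X], g.map (algebraMap (ZMod 2) F) = rootPoly R := by
  classical
  have : CharP F 2 := charP_of_injective_algebraMap (algebraMap (ZMod 2) F).injective 2
  have himg : R.image (frobenius F 2) = R := by
    refine Finset.eq_of_subset_of_card_le ?_ ?_
    · intro x hx
      obtain ⟨β, hβ, rfl⟩ := Finset.mem_image.1 hx
      exact hR β hβ
    · rw [Finset.card_image_of_injective _ (frobenius_inj F 2)]
  have hmap : (rootPoly R).map (frobenius F 2) = rootPoly R := by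
    conv_rhs => rw [rootPoly, ← himg, Finset.prod_image ((frobenius_inj F 2).injOn)]
    rw [rootPoly, Polynomial.map_prod]
    simp
  have hl : rootPoly R ∈ lifts (algebraMap (ZMod 2) F) := by
    rw [lifts_iff_coeff_lifts]
    intro i
    have hi : (rootPoly R).coeff i ^ 2 = (rootPoly R).coeff i := by
      conv_rhs => rw [← hmap, coeff_map, frobenius_def]
    -- Frobenius permutes the roots, so it fixes each coefficient, which is therefore 0 or 1.
    have : (rootPoly R).coeff i * ((rootPoly R).coeff i - 1) = 0 := by
      linear_combination hi
    rcases mul_eq_zero.1 this with h | h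
    · exact ⟨0, by rw [h, map_zero]⟩
    · exact ⟨1, by rw [sub_eq_zero.1 h, map_one]⟩
  exact (mem_lifts _).1 hl

theorem isGeneratorPoly_cyclicCode {R : Finset F} (hn : ∀ β ∈ R, β ^ n = 1) {g : (ZMod 2)[X]}
    (hg : g.map (algebraMap (ZMod 2) F) = rootPoly R) : IsGeneratorPoly g (cyclicCode n R) := by
  have hinj := (algebraMap (ZMod 2) F).injective
  refine ⟨monic_of_injective hinj (hg ▸ monic_rootPoly R), ?_, fun c => ?_⟩
  · rw [← map_dvd_map' (algebraMap (ZMod 2) F), hg, rootPoly_dvd_iff]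
    intro β hβ
    simp [hn β hβ]
  · rw [← map_dvd_map' (algebraMap (ZMod 2) F), hg, rootPoly_dvd_iff, mem_cyclicCode]
    simp only [eval_map_algebraMap]

theorem hasDefiningSet_cyclicCode {R : Finset F} (hR : ∀ β ∈ R, β ^ 2 ∈ R)
    (hn : ∀ β ∈ R, β ^ n = 1) (α : F) :
    HasDefiningSet α (cyclicCode n R) {i : ZMod n | α ^ i.val ∈ R} := by
  obtain ⟨g, hg⟩ := exists_map_eq_rootPoly R hR
  refine ⟨g, isGeneratorPoly_cyclicCode hn hg, ?_⟩
  ext i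
  rw [Set.mem_ofPred_eq, Set.mem_ofPred_eq, ← eval_rootPoly_eq_zero R, ← hg, eval_map_algebraMap]

/-- The code is the kernel of reduction modulo its generator `g`. Reduction is onto, because
remainders have degree below `g.natDegree ≤ n` and so come from words. -/
theorem finrank_cyclicCode_add_card {R : Finset F} (hR : ∀ β ∈ R, β ^ 2 ∈ R)
    (hn : ∀ β ∈ R, β ^ n = 1) (hpos : 0 < n) :
    Module.finrank (ZMod 2) (cyclicCode n R) + R.card = n := by
  obtain ⟨g, hg⟩ := exists_map_eq_rootPoly R hR
  obtain ⟨hmon, hdvd, hmem⟩ := isGeneratorPoly_cyclicCode hn hg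
  have hdeg : g.natDegree = R.card := by
    rw [← natDegree_rootPoly R, ← hg, natDegree_map]
  have hle : g.natDegree ≤ n := by
    have h := natDegree_le_of_dvd hdvd (X_pow_sub_C_ne_zero hpos 1)
    rwa [← C_1, natDegree_X_pow_sub_C] at h
  let φ : (Fin n → ZMod 2) →ₗ[ZMod 2] AdjoinRoot g :=
    (AdjoinRoot.mkₐ g).toLinearMap ∘ₗ wordPolyLinear n
  have hker : LinearMap.ker φ = cyclicCode n R := by
    ext c
    rw [hmem c, LinearMap.mem_ker, ← AdjoinRoot.mk_eq_zero]
    rfl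
  have hsurj : Function.Surjective φ := by
    intro y
    obtain ⟨p, rfl⟩ := AdjoinRoot.mk_surjective y
    obtain ⟨c, hc⟩ := exists_wordPoly_eq (n := n) (p %ₘ g)
      ((degree_modByMonic_lt p hmon).trans_le
        (degree_le_natDegree.trans (by exact_mod_cast hle)))
    refine ⟨c, ?_⟩
    change AdjoinRoot.mk g (wordPoly c) = _
    rw [hc, AdjoinRoot.mk_eq_mk]
    refine ⟨-(p /ₘ g), ?_⟩
    linear_combination modByMonic_add_div p g
  have h := LinearMap.finrank_range_add_finrank_ker φ
  rw [LinearMap.range_eq_top.2 hsurj, finrank_top, hker, Module.finrank_fin_fun,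
    (AdjoinRoot.powerBasis' hmon).finrank, AdjoinRoot.powerBasis'_dim, hdeg] at h
  omega

end Roots

/-! ### Dimensions of dual and extended codes -/

section Dual

variable {n : ℕ}

theorem mem_dual {D : BinaryCode n} {x : Fin n → ZMod 2} :
    x ∈ dual D ↔ ∀ c ∈ D, ∑ i, x i * c i = 0 := Iff.rfl

theorem finrank_add_finrank_dual (D : BinaryCode n) :
    Module.finrank (ZMod 2) D + Module.finrank (ZMod 2) (dual D) = n := by
  have h : dual D = D.dualAnnihilator.comap (dotProductEquiv (ZMod 2) (Fin n)).toLinearMap := by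
    ext x
    rw [mem_dual, Submodule.mem_comap, Submodule.mem_dualAnnihilator]
    rfl
  rw [h, Submodule.comap_equiv_eq_map_symm, LinearEquiv.finrank_map_eq,
    Subspace.finrank_add_finrank_dualAnnihilator_eq, Module.finrank_fin_fun]

theorem eq_dual_of_le {D E : BinaryCode n} (h : E ≤ dual D)
    (hE : Module.finrank (ZMod 2) D + Module.finrank (ZMod 2) E = n) : dual D = E := by
  refine (Submodule.eq_of_le_of_finrank_eq h ?_).symm
  have := finrank_add_finrank_dual D
  omega

theorem last_eq_of_mem_extended {D : BinaryCode n} {x : Fin (n + 1) → ZMod 2}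
    (hx : x ∈ extended D) : x (Fin.last n) = ∑ i : Fin n, x i.castSucc := by
  have h := hx.2
  rw [Fin.sum_univ_castSucc, add_comm] at h
  rw [eq_neg_of_add_eq_zero_left h, ZMod.neg_eq_self_mod_two]

theorem snoc_mem_extended {D : BinaryCode n} {c : Fin n → ZMod 2} (hc : c ∈ D) :
    (Fin.snoc c (∑ i, c i) : Fin (n + 1) → ZMod 2) ∈ extended D := by
  refine ⟨by simpa using hc, ?_⟩
  rw [Fin.sum_univ_castSucc]
  simp [CharTwo.add_self_eq_zero]

theorem finrank_extended (D : BinaryCode n) :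
    Module.finrank (ZMod 2) (extended D) = Module.finrank (ZMod 2) D := by
  let π : (Fin (n + 1) → ZMod 2) →ₗ[ZMod 2] (Fin n → ZMod 2) :=
    LinearMap.funLeft (ZMod 2) (ZMod 2) Fin.castSucc
  let φ : extended D →ₗ[ZMod 2] D := π.restrict fun x hx => hx.1
  refine LinearEquiv.finrank_eq (LinearEquiv.ofBijective φ ⟨?_, ?_⟩)
  · intro x y hxy
    have h : ∀ i : Fin n, x.1 i.castSucc = y.1 i.castSucc := fun i =>
      congrFun (congrArg Subtype.val hxy) i
    refine Subtype.ext (funext fun i => ?_)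
    refine Fin.lastCases ?_ h i
    rw [last_eq_of_mem_extended x.2, last_eq_of_mem_extended y.2]
    exact Finset.sum_congr rfl fun i _ => h i
  · intro c
    refine ⟨⟨_, snoc_mem_extended c.2⟩, Subtype.ext (funext fun i => ?_)⟩
    exact Fin.snoc_castSucc (α := fun _ => ZMod 2) _ _ i

end Dual

/-! ### Orthogonality through values at roots of unity -/

section Parseval

variable {F : Type*} [Field F] [Algebra (ZMod 2) F] {n : ℕ}

/-- Parseval for the discrete Fourier transform: geometric sums kill the cross terms. Two words are
orthogonal as soon as, at each root of unity, the first vanishes there or the second vanishes at the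
inverse. -/
theorem sum_rootsOfUnity_aeval_mul {α : F} (hα : IsPrimitiveRoot α n) (x y : Fin n → ZMod 2) :
    ∑ t ∈ Finset.range n, aeval (α ^ t) (wordPoly x) * aeval (α ^ t)⁻¹ (wordPoly y) =
      n * algebraMap (ZMod 2) F (∑ j, x j * y j) := by
  simp only [aeval_wordPoly, Finset.sum_mul_sum]
  rw [Finset.sum_comm, map_sum, Finset.mul_sum]
  refine Finset.sum_congr rfl fun j _ => ?_
  rw [Finset.sum_comm, Finset.sum_eq_single j]
  · have h0 : α ≠ 0 := hα.ne_zero (Fin.pos j).ne'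
    rw [Finset.sum_congr rfl (g := fun _ => algebraMap (ZMod 2) F (x j * y j))]
    · simp
    · intro t _
      rw [map_mul, mul_mul_mul_comm, ← mul_pow, mul_inv_cancel₀ (pow_ne_zero _ h0), one_pow,
        mul_one]
  · intro l _ hl
    have h0 : α ≠ 0 := hα.ne_zero (Fin.pos j).ne'
    have hne : α ^ (j : ℕ) * (α ^ (l : ℕ))⁻¹ ≠ 1 := by
      rw [Ne, mul_inv_eq_one₀ (pow_ne_zero _ h0)]
      intro h
      exact hl (Fin.ext (hα.pow_inj j.2 l.2 h)).symm
    have hgeom : ∑ t ∈ Finset.range n, (α ^ (j : ℕ) * (α ^ (l : ℕ))⁻¹) ^ t = 0 := by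
      have h := mul_neg_geom_sum (α ^ (j : ℕ) * (α ^ (l : ℕ))⁻¹) n
      rw [mul_pow, inv_pow, ← pow_mul, ← pow_mul, mul_comm (j : ℕ), mul_comm (l : ℕ), pow_mul,
        pow_mul, hα.pow_eq_one, one_pow, one_pow, inv_one, mul_one, sub_self] at h
      exact (mul_eq_zero.1 h).resolve_left (sub_ne_zero.2 hne.symm)
    rw [← mul_zero (algebraMap (ZMod 2) F (x j) * algebraMap (ZMod 2) F (y l)), ← hgeom,
      Finset.mul_sum]
    refine Finset.sum_congr rfl fun t _ => ?_
    rw [mul_mul_mul_comm, mul_pow, inv_pow, inv_pow, ← pow_mul, ← pow_mul, ← pow_mul, ← pow_mul,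
      mul_comm t, mul_comm t]
  · simp

theorem natCast_eq_one_of_odd (hn : Odd n) : (n : F) = 1 := by
  have h : ((n : ZMod 2) : ZMod 2) = 1 := ZMod.natCast_eq_one_iff_odd.2 hn
  rw [← map_natCast (algebraMap (ZMod 2) F), h, map_one]

/-- The dual of a cyclic code: its roots are the inverses of the non-roots. -/
theorem dual_cyclicCode {α : F} (hα : IsPrimitiveRoot α n) (hodd : Odd n) {R R' : Finset F}
    (hR : ∀ β ∈ R, β ^ 2 ∈ R) (hn : ∀ β ∈ R, β ^ n = 1)
    (hR' : ∀ β ∈ R', β ^ 2 ∈ R') (hn' : ∀ β ∈ R', β ^ n = 1)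
    (hc : ∀ β : F, β ^ n = 1 → (β ∈ R' ∨ β⁻¹ ∈ R)) (hcard : R.card + R'.card = n) :
    dual (cyclicCode n R) = cyclicCode n R' := by
  apply eq_dual_of_le
  · intro x hx c hcR
    have h := sum_rootsOfUnity_aeval_mul hα x c
    rw [natCast_eq_one_of_odd hodd, one_mul] at h
    refine (algebraMap (ZMod 2) F).injective ?_
    rw [← h, map_zero]
    refine Finset.sum_eq_zero fun t _ => ?_
    have ht : (α ^ t) ^ n = 1 := by rw [← pow_mul, mul_comm, pow_mul, hα.pow_eq_one, one_pow]
    rcases hc _ ht with h | h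
    · rw [hx _ h, zero_mul]
    · rw [hcR _ h, mul_zero]
  · have h1 := finrank_cyclicCode_add_card hR hn hodd.pos
    have h2 := finrank_cyclicCode_add_card hR' hn' hodd.pos
    omega

/-- If the inverse of every non-root other than `1` is a root, the extended code is
self-orthogonal. -/
theorem extended_cyclicCode_le_dual {α : F} (hα : IsPrimitiveRoot α n) (hodd : Odd n)
    {R : Finset F} (hc : ∀ β : F, β ^ n = 1 → β ≠ 1 → (β ∈ R ∨ β⁻¹ ∈ R)) :
    extended (cyclicCode n R) ≤ dual (extended (cyclicCode n R)) := by
  intro x hx y hy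
  have h := sum_rootsOfUnity_aeval_mul hα (fun i : Fin n => x i.castSucc)
    (fun i : Fin n => y i.castSucc)
  -- Only the term at the root 1 can survive. It is the product of the two parities, which the
  -- product of the appended coordinates cancels.
  rw [natCast_eq_one_of_odd hodd, one_mul, Finset.sum_eq_single 0] at h
  · rw [pow_zero, inv_one] at h
    rw [aeval_wordPoly, aeval_wordPoly] at h
    simp only [one_pow, mul_one, ← map_sum, ← map_mul] at h
    rw [Fin.sum_univ_castSucc, ← (algebraMap (ZMod 2) F).injective h, last_eq_of_mem_extended hx,
      last_eq_of_mem_extended hy]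
    exact CharTwo.add_self_eq_zero _
  · intro t ht h0
    have htn : (α ^ t) ^ n = 1 := by rw [← pow_mul, mul_comm, pow_mul, hα.pow_eq_one, one_pow]
    have ht1 : α ^ t ≠ 1 := hα.pow_ne_one_of_pos_of_lt h0 (Finset.mem_range.1 ht)
    rcases hc _ htn ht1 with h | h
    · rw [hx.1 _ h, zero_mul]
    · rw [hy.1 _ h, mul_zero]
  · intro h0
    exact absurd (Finset.mem_range.2 hodd.pos) h0

end Parseval

/-! ### Weights modulo 4 and minimum distance -/

section Weight

variable {n : ℕ}

theorem hammingNorm_eq_sum_val (x : Fin n → ZMod 2) : hammingNorm x = ∑ i, (x i).val := by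
  rw [hammingNorm, Finset.card_filter]
  refine Finset.sum_congr rfl fun i _ => ?_
  generalize x i = a
  revert a
  decide

theorem hammingNorm_comp (e : Equiv.Perm (Fin n)) (x : Fin n → ZMod 2) :
    hammingNorm (x ∘ e) = hammingNorm x := by
  rw [hammingNorm_eq_sum_val, hammingNorm_eq_sum_val]
  exact Equiv.sum_comp e fun i => (x i).val

theorem hammingNorm_castSucc (x : Fin (n + 1) → ZMod 2) :
    hammingNorm x = hammingNorm (fun i : Fin n => x i.castSucc) + (x (Fin.last n)).val := by
  rw [hammingNorm_eq_sum_val, hammingNorm_eq_sum_val, Fin.sum_univ_castSucc]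

/-- Inclusion-exclusion on supports: `x * y` is the indicator of their intersection. -/
theorem hammingNorm_add (x y : Fin n → ZMod 2) :
    hammingNorm (x + y) + 2 * hammingNorm (x * y) = hammingNorm x + hammingNorm y := by
  simp only [hammingNorm_eq_sum_val, Finset.mul_sum, ← Finset.sum_add_distrib, Pi.add_apply,
    Pi.mul_apply]
  refine Finset.sum_congr rfl fun i _ => ?_
  generalize x i = a
  generalize y i = b
  revert a b
  decide

theorem natCast_hammingNorm (x : Fin n → ZMod 2) : (hammingNorm x : ZMod 2) = ∑ i, x i := by
  rw [hammingNorm_eq_sum_val, Nat.cast_sum]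
  exact Finset.sum_congr rfl fun i _ => ZMod.natCast_zmod_val _

/-- On a self-orthogonal code the weight modulo `4` is additive. -/
theorem natCast_hammingNorm_sum {D : BinaryCode n} (hD : D ≤ dual D) {ι : Type*} (s : Finset ι)
    (f : ι → Fin n → ZMod 2) (hf : ∀ i ∈ s, f i ∈ D) :
    (hammingNorm (∑ i ∈ s, f i) : ZMod 4) = ∑ i ∈ s, (hammingNorm (f i) : ZMod 4) := by
  classical
  induction s using Finset.induction_on with
  | empty => simp
  | insert a s ha ih =>
    have hs : ∑ i ∈ s, f i ∈ D := D.sum_mem fun i hi => hf i (Finset.mem_insert_of_mem hi)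
    have hfa := hf a (Finset.mem_insert_self a s)
    rw [Finset.sum_insert ha, Finset.sum_insert ha,
      ← ih fun i hi => hf i (Finset.mem_insert_of_mem hi), ← Nat.cast_add, ← hammingNorm_add]
    -- The parity of the intersection is an inner product of codewords, hence 0.
    have h2 : 2 ∣ hammingNorm (f a * ∑ i ∈ s, f i) := by
      rw [← ZMod.natCast_eq_zero_iff, natCast_hammingNorm]
      exact hD hfa _ hs
    have h4 : ((2 * hammingNorm (f a * ∑ i ∈ s, f i) : ℕ) : ZMod 4) = 0 := by
      rw [ZMod.natCast_eq_zero_iff]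
      exact mul_dvd_mul_left 2 h2
    rw [Nat.cast_add, h4, add_zero]

/-- The permutation of `n + 1` coordinates that fixes the last one and agrees with `e` on the
others. -/
def extendPerm (e : Equiv.Perm (Fin n)) : Equiv.Perm (Fin (n + 1)) :=
  finSuccEquivLast.symm.permCongr (Equiv.optionCongr e)

theorem extendPerm_castSucc (e : Equiv.Perm (Fin n)) (i : Fin n) :
    extendPerm e i.castSucc = (e i).castSucc := by
  simp [extendPerm]

theorem extendPerm_last (e : Equiv.Perm (Fin n)) : extendPerm e (Fin.last n) = Fin.last n := by
  simp [extendPerm]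

theorem comp_extendPerm_mem {D E : BinaryCode n} {e : Equiv.Perm (Fin n)}
    (h : ∀ c ∈ D, c ∘ e ∈ E) {x : Fin (n + 1) → ZMod 2} (hx : x ∈ extended D) :
    x ∘ extendPerm e ∈ extended E := by
  refine ⟨?_, (Equiv.sum_comp (extendPerm e) x).trans hx.2⟩
  simp only [Function.comp_apply, extendPerm_castSucc]
  exact h _ hx.1

/-- If a cyclic code of length `3` modulo `4` has a self-orthogonal extension, this extension is
doubly even. -/
theorem isDoublyEven_extended [NeZero n] {D : BinaryCode n} (hn : 4 ∣ n + 1)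
    (hshift : ∀ (i : Fin n), ∀ c ∈ D, c ∘ Equiv.addRight i ∈ D)
    (hD : extended D ≤ dual (extended D)) : IsDoublyEven (extended D) := by
  intro x hx
  have hsum := natCast_hammingNorm_sum hD Finset.univ
    (fun i : Fin n => x ∘ extendPerm (Equiv.addRight i))
    (fun i _ => comp_extendPerm_mem (hshift i) hx)
  have hodd : (n : ZMod 2) = 1 := by
    rw [ZMod.natCast_eq_one_iff_odd]
    by_contra h
    have : 2 ∣ n := (Nat.not_odd_iff_even.1 h).two_dvd
    omega
  -- Over all shifts, each cyclic position meets every coordinate once and collects the total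
  -- parity, which is the appended coordinate. The last position collects that coordinate `n` times,
  -- with `n` odd.
  have hconst : ∑ i : Fin n, x ∘ extendPerm (Equiv.addRight i) = fun _ => x (Fin.last n) := by
    funext j
    rw [Finset.sum_apply]
    refine Fin.lastCases ?_ (fun j => ?_) j
    · simp only [Function.comp_apply, extendPerm_last]
      rw [Finset.sum_const, Finset.card_univ, Fintype.card_fin, nsmul_eq_mul, hodd, one_mul]
    · simp only [Function.comp_apply, extendPerm_castSucc, Equiv.coe_addRight]
      rw [last_eq_of_mem_extended hx]
      exact Equiv.sum_comp (Equiv.addLeft j) fun i => x i.castSucc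
  have hzero : (hammingNorm (fun _ : Fin (n + 1) => x (Fin.last n)) : ZMod 4) = 0 := by
    rw [ZMod.natCast_eq_zero_iff, hammingNorm_eq_sum_val, Finset.sum_const, Finset.card_univ,
      Fintype.card_fin, smul_eq_mul]
    exact hn.mul_right _
  simp only [hammingNorm_comp] at hsum
  rw [hconst, hzero, Finset.sum_const, Finset.card_univ, Fintype.card_fin, nsmul_eq_mul,
    ← Nat.cast_mul, eq_comm, ZMod.natCast_eq_zero_iff] at hsum
  -- At this point `4 ∣ n * hammingNorm x`, and 4 is prime to `n` because it divides `n + 1`.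
  refine (Nat.Coprime.dvd_mul_left ?_).1 hsum
  obtain ⟨q, hq⟩ := hn
  refine (Nat.coprime_iff_gcd_eq_one).2 (Nat.dvd_one.1 ?_)
  have h1 := Nat.gcd_dvd_left 4 n
  have h2 := Nat.gcd_dvd_right 4 n
  exact (Nat.dvd_add_right h2).1 (hq ▸ h1.mul_right q)

/-- Positive dimension excludes the default value 0 of the infimum over the empty set. -/
theorem le_minDist {D : BinaryCode n} {b : ℕ} (hpos : 0 < Module.finrank (ZMod 2) D)
    (h : ∀ x ∈ D, x ≠ 0 → b ≤ hammingNorm x) : b ≤ minDist D := by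
  have hne : {d : ℕ | ∃ x ∈ D, ∃ y ∈ D, x ≠ y ∧ hammingDist x y = d}.Nonempty := by
    have : Nontrivial D := Module.nontrivial_of_finrank_pos hpos
    obtain ⟨x, y, hxy⟩ := exists_pair_ne D
    exact ⟨_, x, x.2, y, y.2, Subtype.coe_injective.ne hxy, rfl⟩
  obtain ⟨x, hx, y, hy, hxy, hd⟩ := Nat.sInf_mem hne
  rw [minDist, ← hd, hammingDist_eq_hammingNorm]
  refine h _ ?_ ?_
  · exact D.add_mem (D.neg_mem hx) hy
  · intro h0
    exact hxy (neg_add_eq_zero.1 h0)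

theorem minDist_eq_of_comp_mem {D E : BinaryCode n} (e : Equiv.Perm (Fin n))
    (h₁ : ∀ x ∈ D, x ∘ e ∈ E) (h₂ : ∀ x ∈ E, x ∘ e ∈ D) : minDist D = minDist E := by
  have key : ∀ D E : BinaryCode n, (∀ x ∈ D, x ∘ e ∈ E) →
      {d : ℕ | ∃ x ∈ D, ∃ y ∈ D, x ≠ y ∧ hammingDist x y = d} ⊆
        {d : ℕ | ∃ x ∈ E, ∃ y ∈ E, x ≠ y ∧ hammingDist x y = d} := by
    rintro D E h d ⟨x, hx, y, hy, hxy, hd⟩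
    refine ⟨x ∘ e, h x hx, y ∘ e, h y hy, fun h' => hxy (e.surjective.injective_comp_right h'), ?_⟩
    rw [← hd, hammingDist_eq_hammingNorm, hammingDist_eq_hammingNorm, ← hammingNorm_comp e (-x + y)]
    rfl
  rw [minDist, minDist, (key D E h₁).antisymm (key E D h₂)]

section Bounds

variable {D : BinaryCode n} {w : ℕ}

/-- The extended weight is a multiple of 4 exceeding `w`, itself a multiple of 4. -/
theorem add_four_le_hammingNorm_of_mem_extended (hw : 4 ∣ w) (hD : IsDoublyEven (extended D))
    (h : ∀ c ∈ D, c ≠ 0 → w < hammingNorm c) {x : Fin (n + 1) → ZMod 2} (hx : x ∈ extended D)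
    (h0 : x ≠ 0) : w + 4 ≤ hammingNorm x := by
  have h4 := hD x hx
  have hne : (fun i : Fin n => x i.castSucc) ≠ 0 := by
    intro hz
    refine h0 (funext fun i => Fin.lastCases ?_ (fun i => congrFun hz i) i)
    rw [last_eq_of_mem_extended hx]
    exact Finset.sum_eq_zero fun i _ => congrFun hz i
  have h1 := h _ hx.1 hne
  have h2 := hammingNorm_castSucc x
  omega

theorem add_four_le_hammingNorm_snoc (hw : 4 ∣ w) (hD : IsDoublyEven (extended D))
    (h : ∀ c ∈ D, c ≠ 0 → w < hammingNorm c) {c : Fin n → ZMod 2} (hc : c ∈ D) (h0 : c ≠ 0) :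
    w + 4 ≤ hammingNorm c + (∑ i, c i).val := by
  have h1 := add_four_le_hammingNorm_of_mem_extended hw hD h (snoc_mem_extended hc) (by
    intro hz
    refine h0 (funext fun i => ?_)
    have := congrFun hz i.castSucc
    simpa using this)
  rw [hammingNorm_castSucc] at h1
  simpa using h1

theorem add_three_le_hammingNorm (hw : 4 ∣ w) (hD : IsDoublyEven (extended D))
    (h : ∀ c ∈ D, c ≠ 0 → w < hammingNorm c) {c : Fin n → ZMod 2} (hc : c ∈ D) (h0 : c ≠ 0) :
    w + 3 ≤ hammingNorm c := by
  have h1 := add_four_le_hammingNorm_snoc hw hD h hc h0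
  have h2 := ZMod.val_lt (∑ i, c i)
  omega

end Bounds

end Weight

/-! ### BCH bound, cyclic shifts and reversal -/

section Cyclic

theorem pow_val_add {M : Type*} [Monoid M] {n : ℕ} [NeZero n] {β : M} (hβ : β ^ n = 1)
    (i j : Fin n) : β ^ (i + j).val = β ^ i.val * β ^ j.val := by
  rw [← pow_add, Fin.val_add, ← pow_eq_pow_mod _ hβ]

variable {F : Type*} [Field F] [Algebra (ZMod 2) F] {n : ℕ}

/-- The BCH bound. -/
theorem lt_hammingNorm_of_consecutive_roots {γ : F} (hγ : IsPrimitiveRoot γ n) {a w : ℕ}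
    {c : Fin n → ZMod 2} (hc : c ≠ 0)
    (h : ∀ i < w, aeval (γ ^ (a + i)) (wordPoly c) = 0) : w < hammingNorm c := by
  classical
  by_contra! hle
  obtain ⟨j₀, hj₀⟩ := Function.ne_iff.1 hc
  have hmem : j₀ ∈ Finset.univ.filter fun j => c j ≠ 0 := by simpa using hj₀
  set s := (Finset.univ.filter fun j => c j ≠ 0).erase j₀ with hs
  -- In place of a Vandermonde determinant: `p` vanishes at every support locator except that of
  -- `j₀`. Weighting the `w` vanishing values by the coefficients of `p` isolates the nonzero term
  -- at `j₀`.
  set p : F[X] := ∏ j ∈ s, (X - C (γ ^ (j : ℕ))) with hp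
  have hdeg : p.natDegree < w := by
    rw [hp, natDegree_finsetProd_X_sub_C_eq_card]
    have h1 : s.card < (Finset.univ.filter fun j => c j ≠ 0).card :=
      Finset.card_erase_lt_of_mem hmem
    exact h1.trans_le hle
  have hsum : ∑ j : Fin n,
      algebraMap (ZMod 2) F (c j) * γ ^ (a * j) * p.eval (γ ^ (j : ℕ)) = 0 := by
    simp only [eval_eq_sum_range' hdeg, Finset.mul_sum]
    rw [Finset.sum_comm]
    refine Finset.sum_eq_zero fun i hi => ?_
    have hi' := h i (Finset.mem_range.1 hi)
    rw [aeval_wordPoly] at hi'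
    rw [← mul_zero (p.coeff i), ← hi', Finset.mul_sum]
    refine Finset.sum_congr rfl fun j _ => ?_
    rw [← pow_mul γ (a + i), add_mul, pow_add, ← pow_mul, mul_comm (j : ℕ) i]
    ring
  rw [Finset.sum_eq_single j₀] at hsum
  · have h0 : γ ≠ 0 := hγ.ne_zero (Fin.pos j₀).ne'
    refine mul_ne_zero (mul_ne_zero ?_ (pow_ne_zero _ h0)) ?_ hsum
    · exact (_root_.map_ne_zero _).2 hj₀
    · rw [hp, eval_prod, Finset.prod_ne_zero_iff]
      intro j hj
      rw [eval_sub, eval_X, eval_C, sub_ne_zero]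
      intro hjj
      exact Finset.ne_of_mem_erase hj (Fin.ext (hγ.pow_inj j₀.2 j.2 hjj)).symm
  · intro j _ hj
    by_cases hcj : c j = 0
    · simp [hcj]
    · have hjs : j ∈ s := Finset.mem_erase.2 ⟨hj, by simpa using hcj⟩
      rw [hp, eval_prod, Finset.prod_eq_zero hjs (by simp), mul_zero]
  · simp

theorem aeval_wordPoly_comp_addRight [NeZero n] {β : F} (hβ : β ^ n = 1) (i : Fin n)
    (c : Fin n → ZMod 2) :
    β ^ i.val * aeval β (wordPoly (c ∘ Equiv.addRight i)) = aeval β (wordPoly c) := by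
  rw [aeval_wordPoly, aeval_wordPoly, Finset.mul_sum, ← Equiv.sum_comp (Equiv.addRight i)
    fun j => algebraMap (ZMod 2) F (c j) * β ^ j.val]
  refine Finset.sum_congr rfl fun j _ => ?_
  rw [Equiv.coe_addRight, pow_val_add hβ, Function.comp_apply]
  ring

theorem aeval_wordPoly_comp_neg [NeZero n] {β : F} (hβ : β ^ n = 1) (c : Fin n → ZMod 2) :
    aeval β (wordPoly (c ∘ Equiv.neg (Fin n))) = aeval β⁻¹ (wordPoly c) := by
  rw [aeval_wordPoly, aeval_wordPoly, ← Equiv.sum_comp (Equiv.neg (Fin n))]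
  refine Finset.sum_congr rfl fun j _ => ?_
  have h : β ^ (-j).val * β ^ j.val = 1 := by
    rw [← pow_val_add hβ, neg_add_cancel, Fin.val_zero, pow_zero]
  rw [Function.comp_apply, Equiv.neg_apply, neg_neg, eq_inv_of_mul_eq_one_left h, inv_pow]

theorem comp_addRight_mem_cyclicCode [NeZero n] {R : Finset F} (hn : ∀ β ∈ R, β ^ n = 1)
    (i : Fin n) {c : Fin n → ZMod 2} (hc : c ∈ cyclicCode n R) :
    c ∘ Equiv.addRight i ∈ cyclicCode n R := by
  intro β hβ
  have h := aeval_wordPoly_comp_addRight (hn β hβ) i c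
  rw [hc β hβ] at h
  refine (mul_eq_zero.1 h).resolve_left (pow_ne_zero _ ?_)
  rintro rfl
  have := hn 0 hβ
  rw [zero_pow (NeZero.ne n)] at this
  exact zero_ne_one this

theorem comp_neg_mem_cyclicCode [NeZero n] {R R' : Finset F} (hn : ∀ β ∈ R', β ^ n = 1)
    (h : ∀ β ∈ R', β⁻¹ ∈ R) {c : Fin n → ZMod 2} (hc : c ∈ cyclicCode n R) :
    c ∘ Equiv.neg (Fin n) ∈ cyclicCode n R' := by
  intro β hβ
  rw [aeval_wordPoly_comp_neg (hn β hβ)]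
  exact hc _ (h β hβ)

end Cyclic

/-! ### Binary digits under doubling, complement and multiplication -/

section BinaryWeight

theorem binaryWeight_two_mul (a : ℕ) : binaryWeight (2 * a) = binaryWeight a := by
  rcases Nat.eq_zero_or_pos a with rfl | h
  · rfl
  · rw [binaryWeight, binaryWeight, Nat.digits_base_mul one_lt_two h, List.sum_cons, zero_add]

theorem binaryWeight_two_mul_add_one (a : ℕ) : binaryWeight (2 * a + 1) = binaryWeight a + 1 := by
  rw [binaryWeight, binaryWeight, Nat.digits_def' one_lt_two (Nat.succ_pos _), List.sum_cons,
    show (2 * a + 1) % 2 = 1 by omega, show (2 * a + 1) / 2 = a by omega, add_comm]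

theorem binaryWeight_add_two_pow_mul {k a : ℕ} (ha : a < 2 ^ k) (b : ℕ) :
    binaryWeight (a + 2 ^ k * b) = binaryWeight a + binaryWeight b := by
  induction k generalizing a with
  | zero =>
    obtain rfl : a = 0 := by simpa using ha
    simp [binaryWeight]
  | succ k ih =>
    rw [pow_succ] at ha
    rcases Nat.even_or_odd' a with ⟨c, rfl | rfl⟩
    · have h : 2 * c + 2 ^ (k + 1) * b = 2 * (c + 2 ^ k * b) := by ring
      rw [h, binaryWeight_two_mul, binaryWeight_two_mul, ih (by omega)]
    · have h : 2 * c + 1 + 2 ^ (k + 1) * b = 2 * (c + 2 ^ k * b) + 1 := by ring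
      rw [h, binaryWeight_two_mul_add_one, binaryWeight_two_mul_add_one, ih (by omega)]
      ring

theorem binaryWeight_compl {k a : ℕ} (ha : a < 2 ^ k) :
    binaryWeight (2 ^ k - 1 - a) + binaryWeight a = k := by
  induction k generalizing a with
  | zero =>
    obtain rfl : a = 0 := by simpa using ha
    rfl
  | succ k ih =>
    rw [pow_succ] at ha ⊢
    rcases Nat.even_or_odd' a with ⟨c, rfl | rfl⟩
    · have h : 2 ^ k * 2 - 1 - 2 * c = 2 * (2 ^ k - 1 - c) + 1 := by omega
      rw [h, binaryWeight_two_mul, binaryWeight_two_mul_add_one, add_right_comm,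
        ih (by omega)]
    · have h : 2 ^ k * 2 - 1 - (2 * c + 1) = 2 * (2 ^ k - 1 - c) := by omega
      rw [h, binaryWeight_two_mul, binaryWeight_two_mul_add_one, ← add_assoc, ih (by omega)]

theorem binaryWeight_mul_two_pow_sub_one {k i : ℕ} (hi : i < 2 ^ k) :
    binaryWeight ((2 ^ k - 1) * (1 + i)) = k := by
  -- The high block carries the digits of `i` and the low block their complements, so together they
  -- contain `k` ones.
  have h : (2 ^ k - 1) * (1 + i) = (2 ^ k - 1 - i) + 2 ^ k * i := by
    obtain ⟨q, hq⟩ := Nat.exists_eq_add_of_lt hi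
    have h1 : 2 ^ k - 1 = i + q := by omega
    rw [h1, hq, Nat.add_sub_cancel_left]
    ring
  rw [h, binaryWeight_add_two_pow_mul (by omega), binaryWeight_compl hi]

theorem binaryWeight_two_mul_mod {m j : ℕ} (hj : j < 2 ^ m - 1) :
    binaryWeight (2 * j % (2 ^ m - 1)) = binaryWeight j := by
  rcases m with _ | m
  · simp at hj
  rw [pow_succ] at hj ⊢
  rcases lt_or_ge j (2 ^ m) with h | h
  · rw [Nat.mod_eq_of_lt (by omega), binaryWeight_two_mul]
  -- The leading digit is 1, and reduction moves it to the lowest place.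
  · have h1 : 2 * j % (2 ^ m * 2 - 1) = 2 * (j - 2 ^ m) + 1 := by
      rw [Nat.mod_eq_sub_mod (by omega), Nat.mod_eq_of_lt (by omega)]
      omega
    have h2 := binaryWeight_add_two_pow_mul (k := m) (a := j - 2 ^ m) (by omega) 1
    rw [h1, binaryWeight_two_mul_add_one]
    rw [mul_one, Nat.sub_add_cancel h] at h2
    rw [h2]
    rfl

end BinaryWeight

/-! ### Duadic codes from a splitting by inversion -/

section RootSplitting

variable {F : Type*} [Field F]

/-- `R₁` and `R₂` partition the nontrivial `n`-th roots of unity, are stable under squaring and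
swapped by inversion. -/
structure IsRootSplitting (n : ℕ) (R₁ R₂ : Finset F) : Prop where
  mem_or_mem_iff : ∀ β, β ∈ R₁ ∨ β ∈ R₂ ↔ β ^ n = 1 ∧ β ≠ 1
  notMem : ∀ β ∈ R₁, β ∉ R₂
  sq_mem_left : ∀ β ∈ R₁, β ^ 2 ∈ R₁
  sq_mem_right : ∀ β ∈ R₂, β ^ 2 ∈ R₂
  inv_mem_right : ∀ β ∈ R₁, β⁻¹ ∈ R₂
  inv_mem_left : ∀ β ∈ R₂, β⁻¹ ∈ R₁

namespace IsRootSplitting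

variable {n : ℕ} {R₁ R₂ : Finset F}

theorem symm (h : IsRootSplitting n R₁ R₂) : IsRootSplitting n R₂ R₁ where
  mem_or_mem_iff β := by rw [or_comm, h.mem_or_mem_iff]
  notMem β h₂ h₁ := h.notMem β h₁ h₂
  sq_mem_left := h.sq_mem_right
  sq_mem_right := h.sq_mem_left
  inv_mem_right := h.inv_mem_left
  inv_mem_left := h.inv_mem_right

theorem pow_eq_one (h : IsRootSplitting n R₁ R₂) : ∀ β ∈ R₁, β ^ n = 1 := fun β hβ =>
  ((h.mem_or_mem_iff β).1 (Or.inl hβ)).1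

theorem one_notMem (h : IsRootSplitting n R₁ R₂) : (1 : F) ∉ R₁ := fun h1 =>
  ((h.mem_or_mem_iff 1).1 (Or.inl h1)).2 rfl

theorem mem_or_inv_mem (h : IsRootSplitting n R₁ R₂) {β : F} (hβ : β ^ n = 1) (h1 : β ≠ 1) :
    β ∈ R₁ ∨ β⁻¹ ∈ R₁ :=
  ((h.mem_or_mem_iff β).2 ⟨hβ, h1⟩).imp_right (h.inv_mem_left β)

theorem two_mul_card_add_one (h : IsRootSplitting n R₁ R₂) {α : F} (hα : IsPrimitiveRoot α n)
    (hpos : 0 < n) : 2 * R₁.card + 1 = n := by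
  classical
  have hle : ∀ {R R' : Finset F}, (∀ β ∈ R, β⁻¹ ∈ R') → R.card ≤ R'.card := fun hR =>
    Finset.card_le_card_of_injOn _ hR inv_injective.injOn
  have hcard : R₁.card = R₂.card := (hle h.inv_mem_right).antisymm (hle h.inv_mem_left)
  have hunion : R₁ ∪ R₂ = (nthRootsFinset n (1 : F)).erase 1 := by
    ext β
    rw [Finset.mem_union, h.mem_or_mem_iff, Finset.mem_erase, mem_nthRootsFinset hpos, and_comm]
  have hdisj : Disjoint R₁ R₂ := Finset.disjoint_left.2 fun β => h.notMem β
  have h1 := congrArg Finset.card hunion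
  rw [Finset.card_union_of_disjoint hdisj, Finset.card_erase_of_mem
    ((mem_nthRootsFinset hpos _).2 (one_pow n)), hα.card_nthRootsFinset] at h1
  omega

theorem sq_mem_insert [DecidableEq F] (h : IsRootSplitting n R₁ R₂) :
    ∀ β ∈ insert 1 R₁, β ^ 2 ∈ insert 1 R₁ := by
  intro β hβ
  rcases Finset.mem_insert.1 hβ with rfl | hβ
  · simp
  · exact Finset.mem_insert_of_mem (h.sq_mem_left β hβ)

theorem pow_eq_one_of_mem_insert [DecidableEq F] (h : IsRootSplitting n R₁ R₂) :
    ∀ β ∈ insert 1 R₁, β ^ n = 1 := by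
  intro β hβ
  rcases Finset.mem_insert.1 hβ with rfl | hβ
  · exact one_pow n
  · exact h.pow_eq_one β hβ

variable {α : F}

theorem isSplitting [NeZero n] (h : IsRootSplitting n R₁ R₂) (hα : IsPrimitiveRoot α n) :
    IsSplitting {i : ZMod n | α ^ i.val ∈ R₁} {i : ZMod n | α ^ i.val ∈ R₂} (-1) := by
  have hadd : ∀ i j : ZMod n, α ^ (i + j).val = α ^ i.val * α ^ j.val := fun i j => by
    rw [ZMod.val_add, ← pow_eq_pow_mod _ hα.pow_eq_one, pow_add]
  have hneg : ∀ i : ZMod n,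
      α ^ (i * ((-1 : (ZMod n)ˣ) : ZMod n)).val = (α ^ i.val)⁻¹ := fun i => by
    refine eq_inv_of_mul_eq_one_left ?_
    rw [← hadd]
    simp
  have htwo : ∀ i : ZMod n, α ^ (i * 2).val = (α ^ i.val) ^ 2 := fun i => by
    rw [mul_two, hadd, sq]
  have hcoset : ∀ R : Finset F, (∀ β ∈ R, β ^ 2 ∈ R) → ∃ A : Set (ZMod n),
      {i : ZMod n | α ^ i.val ∈ R} = ⋃ s ∈ A, cyclotomicCoset n s := by
    intro R hR
    refine ⟨{i : ZMod n | α ^ i.val ∈ R}, Set.Subset.antisymm ?_ ?_⟩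
    · intro i hi
      exact Set.mem_biUnion hi ⟨0, by simp⟩
    · refine Set.iUnion₂_subset ?_
      rintro s hs _ ⟨t, rfl⟩
      induction t with
      | zero => simpa using hs
      | succ t ih =>
        rw [Set.mem_ofPred_eq, pow_succ, ← mul_assoc, htwo]
        exact hR _ ih
  have himage : ∀ R R' : Finset F, (∀ β ∈ R, β⁻¹ ∈ R') → (∀ β ∈ R', β⁻¹ ∈ R) →
      (fun i : ZMod n => i * ((-1 : (ZMod n)ˣ) : ZMod n)) '' {i : ZMod n | α ^ i.val ∈ R} =
        {i : ZMod n | α ^ i.val ∈ R'} := by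
    intro R R' hR hR'
    refine Set.Subset.antisymm ?_ ?_
    · rintro _ ⟨i, hi, rfl⟩
      rw [Set.mem_ofPred_eq, hneg]
      exact hR _ hi
    · intro i hi
      refine ⟨i * ((-1 : (ZMod n)ˣ) : ZMod n), ?_, by simp⟩
      rw [Set.mem_ofPred_eq, hneg]
      exact hR' _ hi
  refine ⟨hcoset _ h.sq_mem_left, hcoset _ h.sq_mem_right, ?_, ?_,
    himage _ _ h.inv_mem_right h.inv_mem_left, himage _ _ h.inv_mem_left h.inv_mem_right⟩
  · ext i
    have hi : (α ^ i.val) ^ n = 1 := by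
      rw [← pow_mul, mul_comm, pow_mul, hα.pow_eq_one, one_pow]
    rw [Set.mem_union, Set.mem_ofPred_eq, Set.mem_ofPred_eq, h.mem_or_mem_iff, Set.mem_compl_iff,
      Set.mem_singleton_iff]
    refine ⟨fun hne h0 => hne.2 (by simp [h0]), fun h0 => ⟨hi, ?_⟩⟩
    exact hα.pow_ne_one_of_pos_of_lt (by rwa [Ne, ZMod.val_eq_zero]) (ZMod.val_lt i)
  · ext i
    simp only [Set.mem_inter_iff, Set.mem_ofPred_eq, Set.mem_empty_iff_false, iff_false, not_and]
    exact h.notMem _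

variable [Algebra (ZMod 2) F]

theorem two_mul_finrank (h : IsRootSplitting n R₁ R₂) (hα : IsPrimitiveRoot α n)
    (hpos : 0 < n) : 2 * Module.finrank (ZMod 2) (cyclicCode n R₁) = n + 1 := by
  have h1 := h.two_mul_card_add_one hα hpos
  have h2 := finrank_cyclicCode_add_card h.sq_mem_left h.pow_eq_one hpos
  omega

/-- The non-roots are 1 and `R₂`, and inversion sends them to 1 and `R₁`. -/
theorem dual_eq [DecidableEq F] (h : IsRootSplitting n R₁ R₂) (hα : IsPrimitiveRoot α n) (hodd : Odd n) :
    dual (cyclicCode n R₁) = cyclicCode n (insert 1 R₁) := by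
  refine dual_cyclicCode hα hodd h.sq_mem_left h.pow_eq_one h.sq_mem_insert
    h.pow_eq_one_of_mem_insert (fun β hβ => ?_) ?_
  · by_cases h1 : β = 1
    · exact Or.inl (h1 ▸ Finset.mem_insert_self _ _)
    · exact (h.mem_or_inv_mem hβ h1).imp_left Finset.mem_insert_of_mem
  · rw [Finset.card_insert_of_notMem h.one_notMem]
    have := h.two_mul_card_add_one hα hodd.pos
    omega

theorem two_mul_finrank_dual (h : IsRootSplitting n R₁ R₂) (hα : IsPrimitiveRoot α n)
    (hpos : 0 < n) : 2 * Module.finrank (ZMod 2) (dual (cyclicCode n R₁)) + 1 = n := by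
  have h1 := h.two_mul_finrank hα hpos
  have h2 := finrank_add_finrank_dual (cyclicCode n R₁)
  omega

theorem isSelfDual_extended (h : IsRootSplitting n R₁ R₂) (hα : IsPrimitiveRoot α n)
    (hodd : Odd n) : IsSelfDual (extended (cyclicCode n R₁)) := by
  refine eq_dual_of_le (extended_cyclicCode_le_dual hα hodd fun β hβ h1 =>
    h.mem_or_inv_mem hβ h1) ?_
  have := h.two_mul_finrank hα hodd.pos
  rw [finrank_extended]
  omega

theorem isDoublyEven_extended (h : IsRootSplitting n R₁ R₂) (hα : IsPrimitiveRoot α n)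
    (hodd : Odd n) (hn : 4 ∣ n + 1) : IsDoublyEven (extended (cyclicCode n R₁)) := by
  have : NeZero n := ⟨hodd.pos.ne'⟩
  exact BinaryCode.isDoublyEven_extended hn
    (fun i c hc => comp_addRight_mem_cyclicCode h.pow_eq_one i hc)
    (h.isSelfDual_extended hα hodd).ge

theorem comp_neg_mem [NeZero n] (h : IsRootSplitting n R₁ R₂) :
    ∀ c ∈ cyclicCode n R₁, c ∘ Equiv.neg (Fin n) ∈ cyclicCode n R₂ := fun _ hc =>
  comp_neg_mem_cyclicCode h.symm.pow_eq_one h.inv_mem_left hc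

theorem comp_neg_mem_insert [DecidableEq F] [NeZero n] (h : IsRootSplitting n R₁ R₂) :
    ∀ c ∈ cyclicCode n (insert 1 R₁), c ∘ Equiv.neg (Fin n) ∈ cyclicCode n (insert 1 R₂) := by
  intro c hc
  refine comp_neg_mem_cyclicCode h.symm.pow_eq_one_of_mem_insert (fun β hβ => ?_) hc
  rcases Finset.mem_insert.1 hβ with rfl | hβ
  · simp
  · exact Finset.mem_insert_of_mem (h.inv_mem_left β hβ)

/-- The additional root 1 of the dual expresses even weight. Extension then appends 0, so a dual
word inherits the full extended bound. -/
theorem sum_eq_zero_of_mem_dual (h : IsRootSplitting n R₁ R₂) (hα : IsPrimitiveRoot α n)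
    (hodd : Odd n) {c : Fin n → ZMod 2} (hc : c ∈ dual (cyclicCode n R₁)) :
    c ∈ cyclicCode n R₁ ∧ ∑ i, c i = 0 := by
  classical
  rw [h.dual_eq hα hodd] at hc
  refine ⟨fun β hβ => hc β (Finset.mem_insert_of_mem hβ), ?_⟩
  have h1 := hc 1 (Finset.mem_insert_self _ _)
  simp only [aeval_wordPoly, one_pow, mul_one, ← map_sum] at h1
  exact (map_eq_zero _).1 h1

section Parameters

variable {w : ℕ}

/-- Reversing coordinates carries one code to the other, so a bound on the first suffices. -/
theorem pairParameters (h : IsRootSplitting n R₁ R₂) (hα : IsPrimitiveRoot α n) (hodd : Odd n)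
    (hn : 4 ∣ n + 1) (hw : 4 ∣ w) (hb : ∀ c ∈ cyclicCode n R₁, c ≠ 0 → w < hammingNorm c) :
    PairParameters (cyclicCode n R₁) (cyclicCode n R₂) ((n + 1) / 2) (w + 3) := by
  have : NeZero n := ⟨hodd.pos.ne'⟩
  have h1 := h.two_mul_finrank hα hodd.pos
  have h2 := h.symm.two_mul_finrank hα hodd.pos
  refine ⟨by omega, by omega, minDist_eq_of_comp_mem _ h.comp_neg_mem h.symm.comp_neg_mem,
    le_minDist (by omega) fun c hc h0 => ?_⟩
  exact add_three_le_hammingNorm hw (h.isDoublyEven_extended hα hodd hn) hb hc h0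

theorem pairParameters_dual (h : IsRootSplitting n R₁ R₂) (hα : IsPrimitiveRoot α n)
    (hodd : Odd n) (hn : 4 ∣ n + 1) (hw : 4 ∣ w)
    (hb : ∀ c ∈ cyclicCode n R₁, c ≠ 0 → w < hammingNorm c) :
    PairParameters (dual (cyclicCode n R₁)) (dual (cyclicCode n R₂)) ((n + 1) / 2 - 1)
      (w + 4) := by
  classical
  have : NeZero n := ⟨hodd.pos.ne'⟩
  have h1 := h.two_mul_finrank_dual hα hodd.pos
  have h2 := h.symm.two_mul_finrank_dual hα hodd.pos
  refine ⟨by omega, by omega, ?_, le_minDist (by omega) fun c hc h0 => ?_⟩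
  · rw [h.dual_eq hα hodd, h.symm.dual_eq hα hodd]
    exact minDist_eq_of_comp_mem _ h.comp_neg_mem_insert h.symm.comp_neg_mem_insert
  · obtain ⟨hc, hsum⟩ := h.sum_eq_zero_of_mem_dual hα hodd hc
    have := add_four_le_hammingNorm_snoc hw (h.isDoublyEven_extended hα hodd hn) hb hc h0
    rwa [hsum, ZMod.val_zero, add_zero] at this

theorem pairParameters_extended (h : IsRootSplitting n R₁ R₂) (hα : IsPrimitiveRoot α n)
    (hodd : Odd n) (hn : 4 ∣ n + 1) (hw : 4 ∣ w)
    (hb : ∀ c ∈ cyclicCode n R₁, c ≠ 0 → w < hammingNorm c) :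
    PairParameters (extended (cyclicCode n R₁)) (extended (cyclicCode n R₂)) ((n + 1) / 2)
      (w + 4) := by
  have : NeZero n := ⟨hodd.pos.ne'⟩
  have h1 := h.two_mul_finrank hα hodd.pos
  have h2 := h.symm.two_mul_finrank hα hodd.pos
  have h3 := finrank_extended (cyclicCode n R₁)
  have h4 := finrank_extended (cyclicCode n R₂)
  refine ⟨by omega, by omega, minDist_eq_of_comp_mem _
    (fun x hx => comp_extendPerm_mem h.comp_neg_mem hx)
    (fun x hx => comp_extendPerm_mem h.symm.comp_neg_mem hx),
    le_minDist (by omega) fun c hc h0 => ?_⟩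
  exact add_four_le_hammingNorm_of_mem_extended hw (h.isDoublyEven_extended hα hodd hn) hb hc h0

end Parameters

section Exponents

variable [NeZero n]

theorem isOddLikeDuadicPair (h : IsRootSplitting n R₁ R₂) (hα : IsPrimitiveRoot α n) :
    IsOddLikeDuadicPair α (cyclicCode n R₁) (cyclicCode n R₂) :=
  ⟨_, _, -1, h.isSplitting hα, hasDefiningSet_cyclicCode h.sq_mem_left h.pow_eq_one α,
    hasDefiningSet_cyclicCode h.sq_mem_right h.symm.pow_eq_one α⟩

theorem hasDefiningSet_dual (h : IsRootSplitting n R₁ R₂) (hα : IsPrimitiveRoot α n)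
    (hodd : Odd n) : HasDefiningSet α (dual (cyclicCode n R₁))
      ({0} ∪ {i : ZMod n | α ^ i.val ∈ R₁}) := by
  classical
  have heq : {0} ∪ {i : ZMod n | α ^ i.val ∈ R₁} = {i : ZMod n | α ^ i.val ∈ insert 1 R₁} := by
    ext i
    rw [Set.mem_union, Set.mem_singleton_iff, Set.mem_ofPred_eq, Set.mem_ofPred_eq,
      Finset.mem_insert]
    refine or_congr_left ⟨fun h0 => by simp [h0], fun h1 => ?_⟩
    by_contra h0
    exact hα.pow_ne_one_of_pos_of_lt (by rwa [Ne, ZMod.val_eq_zero]) (ZMod.val_lt i) h1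
  rw [h.dual_eq hα hodd, heq]
  exact hasDefiningSet_cyclicCode h.sq_mem_insert h.pow_eq_one_of_mem_insert α

theorem isEvenLikeDuadicPair_dual (h : IsRootSplitting n R₁ R₂) (hα : IsPrimitiveRoot α n)
    (hodd : Odd n) :
    IsEvenLikeDuadicPair α (dual (cyclicCode n R₁)) (dual (cyclicCode n R₂)) :=
  ⟨_, _, -1, h.isSplitting hα, h.hasDefiningSet_dual hα hodd, h.symm.hasDefiningSet_dual hα hodd⟩

end Exponents

end IsRootSplitting

end RootSplitting

/-! ### Root sets cut out by binary weight -/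

section WeightClasses

variable {F : Type*} [Field F] [DecidableEq F] {r m : ℕ} {S : Finset (ZMod r)} {α : F}

/-- The powers of `α` whose exponents are in `definingExponents r m S`. -/
noncomputable def weightRoots (r m : ℕ) (S : Finset (ZMod r)) (α : F) : Finset F :=
  (definingExponents r m S).image fun i => α ^ i

theorem mem_definingExponents {j : ℕ} : j ∈ definingExponents r m S ↔
    (j ≠ 0 ∧ j < 2 ^ m - 1) ∧ (binaryWeight j : ZMod r) ∈ S := by
  rw [definingExponents, Finset.mem_filter, Finset.mem_Icc]
  refine and_congr_left fun _ => ?_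
  omega

theorem pow_mem_weightRoots (hα : IsPrimitiveRoot α (2 ^ m - 1)) {j : ℕ} (hj : j < 2 ^ m - 1) :
    α ^ j ∈ weightRoots r m S α ↔ j ≠ 0 ∧ (binaryWeight j : ZMod r) ∈ S := by
  rw [weightRoots, Finset.mem_image]
  constructor
  · rintro ⟨i, hi, h⟩
    rw [mem_definingExponents] at hi
    obtain rfl := hα.pow_inj hi.1.2 hj h
    exact ⟨hi.1.1, hi.2⟩
  · rintro ⟨h0, h⟩
    exact ⟨j, mem_definingExponents.2 ⟨⟨h0, hj⟩, h⟩, rfl⟩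

theorem exists_pow_of_mem_weightRoots {β : F} (hβ : β ∈ weightRoots r m S α) :
    ∃ j, j ≠ 0 ∧ j < 2 ^ m - 1 ∧ (binaryWeight j : ZMod r) ∈ S ∧ α ^ j = β := by
  obtain ⟨j, hj, rfl⟩ := Finset.mem_image.1 hβ
  rw [mem_definingExponents] at hj
  exact ⟨j, hj.1.1, hj.1.2, hj.2, rfl⟩

theorem sq_mem_weightRoots (hα : IsPrimitiveRoot α (2 ^ m - 1)) :
    ∀ β ∈ weightRoots r m S α, β ^ 2 ∈ weightRoots r m S α := by
  intro β hβ
  obtain ⟨j, h0, hj, hS, rfl⟩ := exists_pow_of_mem_weightRoots hβ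
  rw [← pow_mul, pow_eq_pow_mod _ hα.pow_eq_one, mul_comm,
    pow_mem_weightRoots hα (Nat.mod_lt _ (by omega)), binaryWeight_two_mul_mod hj]
  refine ⟨fun h => ?_, hS⟩
  -- The modulus is odd, so doubling a nonzero residue cannot give 0.
  have hcop : Nat.Coprime (2 ^ m - 1) 2 := by
    rw [Nat.coprime_two_right, ← Nat.not_even_iff_odd, even_iff_two_dvd]
    rcases m with _ | m
    · simp at hj
    · rw [pow_succ] at hj ⊢
      omega
  have := Nat.le_of_dvd (by omega) (hcop.dvd_of_dvd_mul_left (Nat.dvd_of_mod_eq_zero h))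
  omega

theorem inv_mem_weightRoots (hα : IsPrimitiveRoot α (2 ^ m - 1)) {S' : Finset (ZMod r)}
    (hS : ∀ s ∈ S, (m : ZMod r) - s ∈ S') :
    ∀ β ∈ weightRoots r m S α, β⁻¹ ∈ weightRoots r m S' α := by
  intro β hβ
  obtain ⟨j, h0, hj, hjS, rfl⟩ := exists_pow_of_mem_weightRoots hβ
  have h1 : (α ^ j)⁻¹ = α ^ (2 ^ m - 1 - j) := by
    refine inv_eq_of_mul_eq_one_right ?_
    rw [← pow_add, Nat.add_sub_cancel' hj.le, hα.pow_eq_one]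
  rw [h1, pow_mem_weightRoots hα (by omega)]
  refine ⟨by omega, ?_⟩
  have h2 := congrArg (Nat.cast : ℕ → ZMod r) (binaryWeight_compl (k := m) (a := j) (by omega))
  rw [Nat.cast_add] at h2
  rw [eq_sub_of_add_eq h2]
  exact hS _ hjS

/-- Inversion reflects weight classes by `s ↦ m - s`, and `hS` says that this reflection exchanges
`S` with its complement. -/
theorem isRootSplitting_weightRoots [Fintype (ZMod r)]
    (hα : IsPrimitiveRoot α (2 ^ m - 1)) (hm : m ≠ 0) (hS : ∀ s, s ∈ Sᶜ ↔ (m : ZMod r) - s ∈ S) :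
    IsRootSplitting (2 ^ m - 1) (weightRoots r m S α) (weightRoots r m Sᶜ α) where
  mem_or_mem_iff β := by
    have hpos : 0 < 2 ^ m - 1 := Nat.sub_pos_of_lt (Nat.one_lt_two_pow hm)
    constructor
    · have key : ∀ S' : Finset (ZMod r), β ∈ weightRoots r m S' α →
          β ^ (2 ^ m - 1) = 1 ∧ β ≠ 1 := by
        intro S' hβ
        obtain ⟨j, h0, hj, -, rfl⟩ := exists_pow_of_mem_weightRoots hβ
        exact ⟨by rw [← pow_mul, mul_comm, pow_mul, hα.pow_eq_one, one_pow],
          hα.pow_ne_one_of_pos_of_lt h0 hj⟩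
      exact fun h => h.elim (key _) (key _)
    · rintro ⟨hβ, h1⟩
      have : NeZero (2 ^ m - 1) := ⟨hpos.ne'⟩
      obtain ⟨j, hj, rfl⟩ := hα.eq_pow_of_pow_eq_one hβ
      have h0 : j ≠ 0 := by
        rintro rfl
        exact h1 (pow_zero α)
      rw [pow_mem_weightRoots hα hj, pow_mem_weightRoots hα hj, Finset.mem_compl, ← and_or_left]
      exact ⟨h0, em _⟩
  notMem β hβ hβ' := by
    obtain ⟨j, h0, hj, hjS, rfl⟩ := exists_pow_of_mem_weightRoots hβ
    rw [pow_mem_weightRoots hα hj, Finset.mem_compl] at hβ'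
    exact hβ'.2 hjS
  sq_mem_left := sq_mem_weightRoots hα
  sq_mem_right := sq_mem_weightRoots hα
  inv_mem_right := inv_mem_weightRoots hα fun s hs => by
    rwa [hS, sub_sub_cancel]
  inv_mem_left := inv_mem_weightRoots hα fun s hs => (hS s).1 hs

theorem duadicGenerator_eq_rootPoly (hα : IsPrimitiveRoot α (2 ^ m - 1)) :
    duadicGenerator r m S α = rootPoly (weightRoots r m S α) := by
  rw [duadicGenerator, rootPoly, weightRoots, Finset.prod_image]
  intro i hi j hj hij
  exact hα.pow_inj (mem_definingExponents.1 hi).1.2 (mem_definingExponents.1 hj).1.2 hij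

variable [Algebra (ZMod 2) F]

theorem duadicCode_eq_cyclicCode (hα : IsPrimitiveRoot α (2 ^ m - 1)) :
    duadicCode r m S α = cyclicCode (2 ^ m - 1) (weightRoots r m S α) := by
  ext c
  rw [mem_cyclicCode]
  change duadicGenerator r m S α ∣ _ ↔ _
  rw [duadicGenerator_eq_rootPoly hα, rootPoly_dvd_iff]
  simp only [eval_map_algebraMap]

theorem exists_isGeneratorPoly_duadicCode (hα : IsPrimitiveRoot α (2 ^ m - 1)) :
    ∃ g : (ZMod 2)[X], g.map (algebraMap (ZMod 2) F) = duadicGenerator r m S α ∧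
      IsGeneratorPoly g (duadicCode r m S α) := by
  obtain ⟨g, hg⟩ := exists_map_eq_rootPoly _ (sq_mem_weightRoots (r := r) (S := S) hα)
  refine ⟨g, hg.trans (duadicGenerator_eq_rootPoly hα).symm, ?_⟩
  rw [duadicCode_eq_cyclicCode hα]
  refine isGeneratorPoly_cyclicCode (fun β hβ => ?_) hg
  obtain ⟨j, -, -, -, rfl⟩ := exists_pow_of_mem_weightRoots hβ
  rw [← pow_mul, mul_comm, pow_mul, hα.pow_eq_one, one_pow]

/-- The exponents `(2 ^ K - 1) * i` with `1 ≤ i ≤ 2 ^ K` have binary weight `K`, which yields long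
arithmetic progressions of zeros. -/
theorem lt_hammingNorm_of_binaryWeight (hα : IsPrimitiveRoot α (2 ^ m - 1)) {K k : ℕ}
    (hK : (K : ZMod r) ∈ S) (hK0 : K ≠ 0) (hKm : Nat.Coprime K m) (hkK : k ≤ K)
    (hlt : (2 ^ K - 1) * 2 ^ k < 2 ^ m - 1) {c : Fin (2 ^ m - 1) → ZMod 2}
    (hc : c ∈ cyclicCode (2 ^ m - 1) (weightRoots r m S α)) (h0 : c ≠ 0) :
    2 ^ k < hammingNorm c := by
  -- The gcd is `2 ^ gcd(K, m) - 1 = 1`, so `α ^ (2 ^ K - 1)` is again primitive and its powers can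
  -- serve in the BCH bound.
  have hcop : Nat.Coprime (2 ^ K - 1) (2 ^ m - 1) := by
    rw [Nat.coprime_iff_gcd_eq_one, Nat.pow_sub_one_gcd_pow_sub_one, hKm.gcd_eq_one]
    rfl
  refine lt_hammingNorm_of_consecutive_roots (hα.pow_of_coprime _ hcop) (a := 1) h0
    fun i hi => hc _ ?_
  have hK1 : 1 < 2 ^ K := Nat.one_lt_two_pow hK0
  have hle : (2 ^ K - 1) * (1 + i) ≤ (2 ^ K - 1) * 2 ^ k := Nat.mul_le_mul_left _ (by omega)
  rw [← pow_mul, pow_mem_weightRoots hα (hle.trans_lt hlt), binaryWeight_mul_two_pow_sub_one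
    (hi.trans_le (Nat.pow_le_pow_right two_pos hkK))]
  exact ⟨Nat.mul_ne_zero (by omega) (by omega), hK⟩

/-- For odd `m = 2 * k + 1`, one of the weights `k` and `k + 1` is in `S`, whence a lower bound
`2 ^ k + 1` for the weights. -/
theorem two_pow_lt_hammingNorm [Fintype (ZMod r)] {k : ℕ} (hα : IsPrimitiveRoot α (2 ^ m - 1))
    (hm : m = 2 * k + 1) (hk : k ≠ 0) (hS : ∀ s, s ∈ Sᶜ ↔ (m : ZMod r) - s ∈ S)
    {c : Fin (2 ^ m - 1) → ZMod 2} (hc : c ∈ cyclicCode (2 ^ m - 1) (weightRoots r m S α))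
    (h0 : c ≠ 0) : 2 ^ k < hammingNorm c := by
  have hpow : 2 ^ m = 2 * (2 ^ k * 2 ^ k) := by rw [hm, pow_succ, two_mul, pow_add, mul_comm]
  have hk1 : 1 < 2 ^ k := Nat.one_lt_two_pow hk
  have hsq : 2 ^ k < 2 ^ k * 2 ^ k := lt_mul_of_one_lt_left (by omega) hk1
  by_cases h : (k : ZMod r) ∈ S
  · refine lt_hammingNorm_of_binaryWeight hα h hk ?_ le_rfl ?_ hc h0
    · rw [hm, Nat.coprime_mul_right_add_right]
      exact Nat.coprime_one_right k
    · rw [Nat.sub_mul, hpow]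
      omega
  · have h' : ((k + 1 : ℕ) : ZMod r) ∈ S := by
      have h1 := (hS k).1 (Finset.mem_compl.2 h)
      have h2 : (m : ZMod r) - k = ((k + 1 : ℕ) : ZMod r) := by
        rw [hm]
        push_cast
        ring
      rwa [h2] at h1
    refine lt_hammingNorm_of_binaryWeight hα h' (Nat.succ_ne_zero k) ?_ (Nat.le_succ k) ?_ hc h0
    · rw [hm, two_mul, add_assoc, Nat.coprime_add_self_right]
      exact Nat.coprime_self_add_left.2 (Nat.coprime_one_left k)
    -- The largest exponent is `2 ^ m - 2 ^ k`, below `2 ^ m - 1` exactly because `2 ^ k > 1`.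
    · rw [Nat.sub_mul, hpow, pow_succ, mul_right_comm]
      omega

end WeightClasses

end BinaryCode

/-! ### The case `r = 8` -/

theorem theorem12 {F : Type*} [Field F] [Finite F] [Algebra (ZMod 2) F]
    (m : ℕ) (hm : m ≡ 5 [MOD 8]) (hF : Nat.card F = 2 ^ m)
    (α : F) (hα : IsPrimitiveRoot α (2 ^ m - 1))
    (S : Finset (ZMod 8)) (b : ℕ)
    (hSb : (S = {0, 1, 2, 6} ∧ b = 1) ∨
      (S = {0, 1, 3, 7} ∧ b = 3) ∨
      ((S = {0, 1, 2, 7} ∨ S = {0, 3, 4, 6}) ∧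
        ((m ≡ 5 [MOD 16] ∧ b = 1) ∨ (m ≡ 13 [MOD 16] ∧ b = 3))) ∨
      ((S = {0, 1, 3, 6} ∨ S = {0, 2, 4, 7}) ∧
        ((m ≡ 5 [MOD 16] ∧ b = 3) ∨ (m ≡ 13 [MOD 16] ∧ b = 1))))
    (C C' : BinaryCode (2 ^ m - 1))
    (hC : C = BinaryCode.duadicCode 8 m S α) (hC' : C' = BinaryCode.duadicCode 8 m Sᶜ α) :
    -- the codes are the binary cyclic codes with the prescribed generator polynomials
    ((∃ g : Polynomial (ZMod 2),
        g.map (algebraMap (ZMod 2) F) = BinaryCode.duadicGenerator 8 m S α ∧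
        BinaryCode.IsGeneratorPoly g C) ∧
      (∃ g : Polynomial (ZMod 2),
        g.map (algebraMap (ZMod 2) F) = BinaryCode.duadicGenerator 8 m Sᶜ α ∧
        BinaryCode.IsGeneratorPoly g C')) ∧
    -- the codes themselves
    (BinaryCode.IsOddLikeDuadicPair α C C' ∧
      BinaryCode.PairParameters C C' (2 ^ (m - 1)) (2 ^ ((m - 1) / 2) + b)) ∧
    -- the dual codes
    (BinaryCode.IsEvenLikeDuadicPair α C.dual C'.dual ∧
      BinaryCode.PairParameters C.dual C'.dual (2 ^ (m - 1) - 1)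
        (2 ^ ((m - 1) / 2) + (b + 1))) ∧
    -- the extended codes
    (BinaryCode.PairParameters C.extended C'.extended (2 ^ (m - 1)) (2 ^ ((m - 1) / 2) + 4) ∧
      C.extended.IsSelfDual ∧ C'.extended.IsSelfDual ∧
      C.extended.IsDoublyEven ∧ C'.extended.IsDoublyEven) := by
  classical
  -- With `m` replaced by 5, this is a finite check for each listed set.
  have hS : ∀ s, s ∈ Sᶜ ↔ (m : ZMod 8) - s ∈ S := by
    rw [(ZMod.natCast_eq_natCast_iff m 5 8).2 hm]
    rcases hSb with ⟨rfl, -⟩ | ⟨rfl, -⟩ | ⟨rfl | rfl, -⟩ | ⟨rfl | rfl, -⟩ <;> decide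
  have hb : b ≤ 3 := by omega
  obtain ⟨k, hk⟩ : ∃ k, m = 2 * k + 1 := by
    rw [Nat.ModEq] at hm
    exact ⟨m / 2, by omega⟩
  -- From `m ≥ 5`; this makes `2 ^ k` a multiple of 4, as the rounding of weights requires.
  have hk2 : 2 ≤ k := by
    rw [Nat.ModEq] at hm
    omega
  have hw : 4 ∣ 2 ^ k := (pow_dvd_pow 2 hk2 : 2 ^ 2 ∣ 2 ^ k)
  have hpow : 2 ^ m = 2 * (2 ^ k * 2 ^ k) := by rw [hk, pow_succ, two_mul, pow_add, mul_comm]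
  have h4 : 4 ∣ 2 ^ m := hw.trans (pow_dvd_pow 2 (by omega))
  have hpos : 0 < 2 ^ m := Nat.two_pow_pos m
  have hn : 4 ∣ 2 ^ m - 1 + 1 := by rwa [Nat.sub_add_cancel hpos]
  have hodd : Odd (2 ^ m - 1) := by
    rw [Nat.odd_iff]
    omega
  have hhalf : (2 ^ m - 1 + 1) / 2 = 2 ^ (m - 1) := by
    rw [Nat.sub_add_cancel hpos, hk, Nat.add_sub_cancel, pow_succ, Nat.mul_div_cancel _ two_pos]
  have hmk : (m - 1) / 2 = k := by omega
  have : NeZero (2 ^ m - 1) := ⟨hodd.pos.ne'⟩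
  have h := BinaryCode.isRootSplitting_weightRoots hα (by omega) hS
  have hwt := fun c hc h0 =>
    BinaryCode.two_pow_lt_hammingNorm hα hk (c := c) (by omega) hS hc h0
  -- Weakens the uniform bounds `2 ^ k + 3` and `2 ^ k + 4` to `2 ^ k + b` and `2 ^ k + (b + 1)`.
  have hmono : ∀ {N : ℕ} {D E : BinaryCode N} {l a a' : ℕ}, a' ≤ a →
      BinaryCode.PairParameters D E l a → BinaryCode.PairParameters D E l a' :=
    fun ha hp => ⟨hp.1, hp.2.1, hp.2.2.1, ha.trans hp.2.2.2⟩
  have hg := BinaryCode.exists_isGeneratorPoly_duadicCode (S := S) hα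
  have hg' := BinaryCode.exists_isGeneratorPoly_duadicCode (S := Sᶜ) hα
  rw [← hC] at hg
  rw [← hC'] at hg'
  refine ⟨⟨hg, hg'⟩, ?_⟩
  rw [hC, hC', BinaryCode.duadicCode_eq_cyclicCode hα, BinaryCode.duadicCode_eq_cyclicCode hα,
    hmk, ← hhalf]
  exact ⟨⟨h.isOddLikeDuadicPair hα,
      hmono (by omega) (h.pairParameters hα hodd hn hw hwt)⟩,
    ⟨h.isEvenLikeDuadicPair_dual hα hodd,
      hmono (by omega) (h.pairParameters_dual hα hodd hn hw hwt)⟩,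
    h.pairParameters_extended hα hodd hn hw hwt,
    h.isSelfDual_extended hα hodd, h.symm.isSelfDual_extended hα hodd,
    h.isDoublyEven_extended hα hodd hn, h.symm.isDoublyEven_extended hα hodd hn⟩
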